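/- Let $g\ge 1$, let $\mathfrak H_g$ be the Siegel half space of symmetric complex $g\times g$ matrices $\tau=(\tau_{jl})$ with positive definite imaginary part, and let $\mathfrak K=\{0,1\}^{2g}$, identified with $(\mathbb Z/2\mathbb Z)^{2g}$ (so that sums of elements of $\mathfrak K$ are taken modulo $2$). For $a=(a',a'')\in\mathfrak K$ put $|a|={}^ta'a''$ and $$\vartheta_a(z,\tau)=\sum_{n\in\mathbb Z^g}\exp\bigl(\pi i\,{}^t(n+\tfrac12a')\,\tau\,(n+\tfrac12a')+2\pi i\,{}^t(n+\tfrac12a')(z+\tfrac12a'')\bigr),\qquad z\in\mathbb C^g,\ \tau\in\mathfrak H_g.$$ Let $\mathfrak K_+$ and $\mathfrak K_-$ be the sets of $a\in\mathfrak K$ with $|a|$ even and odd respectively. Write $\vartheta_a=\vartheta_a(0,\tau)$ for the thetanulls, and $$\psi_{a,jj}=\frac{1}{\vartheta_a}\cdot\frac1{\pi i}\frac{\partial\vartheta_a}{\partial\tau_{jj}}\qquad(j=1,\dots,g).$$ Then the theta series converge absolutely and the derivatives that occur here exist, and for all $a\in\mathfrak K_-$ and $j=1,\dots,g$ the following equalities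 of meromorphic functions on $\mathfrak H_g$ hold: $$\text{(i)}\quad\Bigl(\frac1{2\pi i\,\vartheta_0}\frac{\partial\vartheta_a}{\partial z_j}\Big|_{z=0}\Bigr)^2=\frac1{2^{g-1}}\sum_{b\in\mathfrak K_+}(-1)^{{}^ta'b''}\Bigl(\frac{\vartheta_{a+b}}{\vartheta_0}\Bigr)^2\Bigl(\frac{\vartheta_b}{\vartheta_0}\Bigr)^2(\psi_{a+b,jj}-\psi_{0,jj});$$ $$\text{(ii)}\quad\Bigl(\frac1{2\pi i}\frac{\partial\vartheta_a}{\partial z_j}\Big|_{z=0}\Bigr)^4=\frac1{2^{g-1}}\sum_{b\in\mathfrak K_+}(-1)^{|a+b|}\,\vartheta_b^4\,\psi_{b,jj}^2.$$ Here (i) holds at every $\tau\in\mathfrak H_g$ with $\vartheta_0(\tau)\ne0$ and (ii) at every $\tau\in\mathfrak H_g$, where $\psi_{c,jj}(\tau)$ is read as $0$ when $\vartheta_c(\tau)=0$ (in particular, for all $\tau$ when $c$ is odd). -/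

import Mathlib

namespace SiegelTheta

/-- The Siegel half space of degree `g`: complex symmetric matrices with positive definite
imaginary part. -/
def halfSpace (g : ℕ) : Set (Matrix (Fin g) (Fin g) ℂ) :=
  {τ | τ.IsSymm ∧ (τ.map Complex.im).PosDef}

/-- Reduced characteristics `a = (a', a'')`. The entries of `a'` and `a''` are identified with
their representatives in `{0, 1}` through `ZMod.val`; the sum of two characteristics is taken
modulo `2`. -/
abbrev Characteristic (g : ℕ) : Type := (Fin g → ZMod 2) × (Fin g → ZMod 2)

/-- The number `ᵗu · v` for `u, v ∈ {0,1}^g`. -/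
def pairing {g : ℕ} (u v : Fin g → ZMod 2) : ℕ := ∑ i, (u i).val * (v i).val

/-- The number `|a| = ᵗa' · a''`. -/
def Characteristic.abs {g : ℕ} (a : Characteristic g) : ℕ := pairing a.1 a.2

/-- The set of even characteristics. -/
def evenChars (g : ℕ) : Finset (Characteristic g) := {a | Even (Characteristic.abs a)}

/-- The set of odd characteristics. -/
def oddChars (g : ℕ) : Finset (Characteristic g) := {a | Odd (Characteristic.abs a)}

/-- The vector `n + u/2`. -/
noncomputable def shift {g : ℕ} (n : Fin g → ℤ) (u : Fin g → ZMod 2) : Fin g → ℂ :=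
  fun i => (n i : ℂ) + ((u i).val : ℂ) / 2

/-- The term of index `n` of the theta series:
`exp (πi ᵗ(n + a'/2) τ (n + a'/2) + 2πi ᵗ(n + a'/2) (z + a''/2))`. -/
noncomputable def thetaTerm {g : ℕ} (a : Characteristic g) (z : Fin g → ℂ)
    (τ : Matrix (Fin g) (Fin g) ℂ) (n : Fin g → ℤ) : ℂ :=
  Complex.exp (Real.pi * Complex.I * (shift n a.1 ⬝ᵥ Matrix.mulVec τ (shift n a.1))
    + 2 * Real.pi * Complex.I *
      (shift n a.1 ⬝ᵥ (z + fun i => ((a.2 i).val : ℂ) / 2)))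

/-- The theta function with characteristic `a`. -/
noncomputable def theta {g : ℕ} (a : Characteristic g) (z : Fin g → ℂ)
    (τ : Matrix (Fin g) (Fin g) ℂ) : ℂ :=
  ∑' n : Fin g → ℤ, thetaTerm a z τ n

/-- The thetanull with characteristic `a`, a function on the Siegel half space. -/
noncomputable def thetanull {g : ℕ} (a : Characteristic g)
    (τ : Matrix (Fin g) (Fin g) ℂ) : ℂ :=
  theta a 0 τ

/-- The direction of the coordinate `τ_{jl} = τ_{lj}` in the space of symmetric matrices. -/
def coordDir {g : ℕ} (j l : Fin g) : Matrix (Fin g) (Fin g) ℂ :=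
  if j = l then Matrix.single j j 1 else Matrix.single j l 1 + Matrix.single l j 1

/-- The derivations `δ_{jj} = (1/πi) ∂/∂τ_{jj}` and `δ_{jl} = (1/2πi) ∂/∂τ_{jl}` for `j ≠ l`,
in the independent coordinates `τ_{jl}`, `j ≤ l`, on the symmetric matrices. -/
noncomputable def delta {g : ℕ} (j l : Fin g) (f : Matrix (Fin g) (Fin g) ℂ → ℂ)
    (τ : Matrix (Fin g) (Fin g) ℂ) : ℂ :=
  (if j = l then 1 / (Real.pi * Complex.I) else 1 / (2 * Real.pi * Complex.I))
    * lineDeriv ℂ f τ (coordDir j l)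

/-- The logarithmic derivatives `ψ_{a,jl} = δ_{jl} ϑ_a / ϑ_a` of the thetanulls (with value `0`
at the points where the thetanull vanishes). -/
noncomputable def psi {g : ℕ} (a : Characteristic g) (j l : Fin g)
    (τ : Matrix (Fin g) (Fin g) ℂ) : ℂ :=
  delta j l (thetanull a) τ / thetanull a τ

/-- The value at `z = 0` of the partial derivative `∂ϑ_a/∂z_j`. -/
noncomputable def thetaDeriv {g : ℕ} (a : Characteristic g) (j : Fin g)
    (τ : Matrix (Fin g) (Fin g) ℂ) : ℂ :=
  lineDeriv ℂ (fun z : Fin g → ℂ => theta a z τ) 0 (Pi.single j 1)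

end SiegelTheta

/-!
Both identities are consequences of Riemann's quartic theta formula. Write `D = (1/2πi) ∂/∂z_j`. A
theta series may be differentiated term by term, and `D` multiplies its term of index `m = n + a'/2`
by `m_j`, while `(1/πi) ∂/∂τ_jj` multiplies it by `m_j²`. So every quantity in the theorem is a
`moment`: the sum of the terms at `z = 0` with weight `m_j^k`, for `k = 0, 1, 2`. Moments of the
wrong parity vanish (`moment_eq_zero`).

A product of four moments is a sum over quadruples of points of the half-integral lattice. One half
of the Hadamard matrix of order four is an orthogonal involution, so it preserves the product of the
four Gaussians, and orthogonality of characters of `(ℤ/2ℤ)^g` rewrites the image of the product of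
cosets for the characteristics `a, a, c, c` as a signed sum over `b` of those for
`b, b, a + b + c, a + b + c`. This gives Riemann's formula with polynomial weights
(`hasSum_riemann`): a weight `W(x, y, u, v)` on one side becomes its transform `W'(p, q, r, s)` on
the other. The identity of signs holds coordinate by coordinate, and there it is a finite check
on `ℤ/2ℤ` (`sum_localSign_mul`).

For (i), take `c = 0` and `xy + uv = (p² + q² - r² - s²) / 2`
(`moment_one_sq_mul_thetanull_sq`); the translation `b ↦ a + b` reverses the sign, since `a` is odd,
which merges the two halves of the sum and also removes the contribution of `ψ_0`. For (ii), take
`c = a` and a quartic form with `xyuv` as its only monomial in all four variables, whose transform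
is a combination of the monomials `p²q²` only (`quarticWeight_hadamard`, `moment_one_pow_four`).
-/

namespace SiegelTheta

/-! ### Absolute convergence -/

/-- The quadratic form is bounded below by its minimum on the unit sphere of the sup norm. -/
lemma exists_mul_sum_sq_le_of_posDef {g : ℕ} {Y : Matrix (Fin g) (Fin g) ℝ} (hY : Y.PosDef) :
    ∃ c : ℝ, 0 < c ∧ ∀ x : Fin g → ℝ, c * ∑ i, x i ^ 2 ≤ x ⬝ᵥ Y.mulVec x := by
  have hcont : Continuous fun x : Fin g → ℝ => x ⬝ᵥ Y.mulVec x := by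
    simp only [dotProduct, Matrix.mulVec]
    fun_prop
  obtain ⟨μ, hμ, hmin⟩ : ∃ μ : ℝ, 0 < μ ∧
      ∀ x ∈ Metric.sphere (0 : Fin g → ℝ) 1, μ ≤ x ⬝ᵥ Y.mulVec x := by
    rcases (Metric.sphere (0 : Fin g → ℝ) 1).eq_empty_or_nonempty with h | h
    · exact ⟨1, one_pos, by simp [h]⟩
    · obtain ⟨x, hx, hle⟩ := (isCompact_sphere _ _).exists_isMinOn h hcont.continuousOn
      have hx0 : x ≠ 0 := by
        rintro rfl
        simp at hx
      have hpos := hY.dotProduct_mulVec_pos hx0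
      exact ⟨_, by simpa using hpos, fun y hy => hle hy⟩
  refine ⟨μ / (g + 1), by positivity, fun x => ?_⟩
  have hsum : ∑ i, x i ^ 2 ≤ (g + 1) * ‖x‖ ^ 2 := by
    calc ∑ i, x i ^ 2 ≤ ∑ _i : Fin g, ‖x‖ ^ 2 := by
          refine Finset.sum_le_sum fun i _ => ?_
          rw [← sq_abs]
          gcongr
          exact norm_le_pi_norm x i
      _ ≤ (g + 1) * ‖x‖ ^ 2 := by
          simp only [Finset.sum_const, Finset.card_univ, Fintype.card_fin, nsmul_eq_mul]
          gcongr
          linarith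
  have hq : μ * ‖x‖ ^ 2 ≤ x ⬝ᵥ Y.mulVec x := by
    rcases eq_or_ne x 0 with rfl | hx
    · simp
    · have hn : ‖x‖ ≠ 0 := norm_ne_zero_iff.mpr hx
      have hunit := hmin (‖x‖⁻¹ • x) (by simp [norm_smul, hn])
      rw [Matrix.mulVec_smul, smul_dotProduct, dotProduct_smul, smul_eq_mul, smul_eq_mul] at hunit
      calc μ * ‖x‖ ^ 2 ≤ (‖x‖⁻¹ * (‖x‖⁻¹ * x ⬝ᵥ Y.mulVec x)) * ‖x‖ ^ 2 := by gcongr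
        _ = _ := by field_simp
  calc μ / (g + 1) * ∑ i, x i ^ 2 ≤ μ / (g + 1) * ((g + 1) * ‖x‖ ^ 2) := by gcongr
    _ = μ * ‖x‖ ^ 2 := by field_simp
    _ ≤ _ := hq

lemma summable_prod_pi {g : ℕ} (f : Fin g → ℤ → ℝ) (h0 : ∀ i n, 0 ≤ f i n)
    (hf : ∀ i, Summable (f i)) : Summable fun n : Fin g → ℤ => ∏ i, f i (n i) := by
  induction g with
  | zero => exact Summable.of_finite
  | succ g ih =>
    rw [← (Fin.consEquiv fun _ : Fin (g + 1) => ℤ).summable_iff]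
    have := (hf 0).mul_of_nonneg (ih (fun i => f i.succ) (fun i => h0 _) fun i => hf _)
      (h0 0) (fun n => Finset.prod_nonneg fun i _ => h0 _ _)
    refine this.congr fun n => ?_
    simp [Fin.prod_univ_succ, Fin.consEquiv]

lemma summable_exp_neg_abs_int : Summable fun n : ℤ => Real.exp (-|(n : ℝ)|) := by
  have h : Summable fun n : ℕ => Real.exp (-(n : ℝ)) := Real.summable_exp_neg_nat
  refine Summable.of_nat_of_neg ?_ ?_ <;> simpa using h

lemma summable_exp_quadratic {c : ℝ} (hc : 0 < c) (C s : ℝ) :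
    Summable fun n : ℤ => Real.exp (-c * (n + s) ^ 2 + C * |(n : ℝ) + s|) := by
  refine Summable.of_nonneg_of_le (fun _ => (Real.exp_pos _).le) (fun n => ?_)
    (summable_exp_neg_abs_int.mul_left (Real.exp ((C + 1) ^ 2 / (4 * c) + |s|)))
  rw [← Real.exp_add]
  apply Real.exp_le_exp.mpr
  set y := |(n : ℝ) + s| with hy
  have h1 : |(n : ℝ)| ≤ y + |s| := by
    calc |(n : ℝ)| = |((n : ℝ) + s) - s| := by ring_nf
      _ ≤ _ := abs_sub _ _
  -- Completing the square: `-c y² + (C + 1) y ≤ (C + 1)² / (4c)`.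
  have h2 : -c * y ^ 2 + (C + 1) * y ≤ (C + 1) ^ 2 / (4 * c) := by
    rw [le_div_iff₀ (by positivity)]
    nlinarith [sq_nonneg (2 * c * y - (C + 1))]
  rw [← sq_abs ((n : ℝ) + s), ← hy]
  linarith

/-- The vector `n + u/2` with real entries. -/
noncomputable def realShift {g : ℕ} (n : Fin g → ℤ) (u : Fin g → ZMod 2) : Fin g → ℝ :=
  fun i => (n i : ℝ) + ((u i).val : ℝ) / 2

lemma shift_eq_ofReal {g : ℕ} (n : Fin g → ℤ) (u : Fin g → ZMod 2) (i : Fin g) :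
    shift n u i = (realShift n u i : ℂ) := by
  simp [shift, realShift, -ZMod.natCast_val]

lemma norm_shift {g : ℕ} (n : Fin g → ℤ) (u : Fin g → ZMod 2) (i : Fin g) :
    ‖shift n u i‖ = |realShift n u i| := by
  rw [shift_eq_ofReal, Complex.norm_real, Real.norm_eq_abs]

lemma norm_thetaTerm {g : ℕ} (a : Characteristic g) (z : Fin g → ℂ)
    (τ : Matrix (Fin g) (Fin g) ℂ) (n : Fin g → ℤ) :
    ‖thetaTerm a z τ n‖ = Real.exp
      (-Real.pi * (realShift n a.1 ⬝ᵥ (τ.map Complex.im).mulVec (realShift n a.1))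
        - 2 * Real.pi * ∑ i, realShift n a.1 i * (z i).im) := by
  have h1 : (shift n a.1 ⬝ᵥ τ.mulVec (shift n a.1)).im =
      realShift n a.1 ⬝ᵥ (τ.map Complex.im).mulVec (realShift n a.1) := by
    simp [dotProduct, Matrix.mulVec, shift_eq_ofReal]
  have h2 : (shift n a.1 ⬝ᵥ (z + fun i => ((a.2 i).val : ℂ) / 2)).im =
      ∑ i, realShift n a.1 i * (z i).im := by
    have h3 (m : ℕ) : ((m : ℂ) / 2).im = 0 := by
      rw [show (m : ℂ) / 2 = ((m / 2 : ℝ) : ℂ) by push_cast; ring, Complex.ofReal_im]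
    simp [dotProduct, shift_eq_ofReal, h3, -ZMod.natCast_val]
  rw [thetaTerm, Complex.norm_exp]
  congr 1
  have h4 (w : ℂ) : (Real.pi * Complex.I * w).re = -Real.pi * w.im := by
    simp
  rw [show (2 : ℂ) * Real.pi * Complex.I * (shift n a.1 ⬝ᵥ (z + fun i => ((a.2 i).val : ℂ) / 2))
    = ((2 : ℝ) : ℂ) * (Real.pi * Complex.I *
      (shift n a.1 ⬝ᵥ (z + fun i => ((a.2 i).val : ℂ) / 2))) by push_cast; ring,
    Complex.add_re, Complex.re_ofReal_mul, h4, h4, h1, h2]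
  ring

/-- The theta series still converges after multiplication of its terms by a Gaussian factor of
small positive exponent. This absorbs every polynomial factor and every small perturbation of
the exponents. -/
lemma exists_summable_norm_thetaTerm_mul_exp {g : ℕ} {τ : Matrix (Fin g) (Fin g) ℂ}
    (hτ : τ ∈ halfSpace g) :
    ∃ ε : ℝ, 0 < ε ∧ ∀ (a : Characteristic g) (z : Fin g → ℂ),
      Summable fun n => ‖thetaTerm a z τ n‖ *
        Real.exp (ε * ∑ i, ‖shift n a.1 i‖ ^ 2) := by
  obtain ⟨c, hc, hle⟩ := exists_mul_sum_sq_le_of_posDef hτ.2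
  have hpi := Real.pi_pos
  refine ⟨Real.pi * c / 2, by positivity, fun a z => ?_⟩
  refine Summable.of_nonneg_of_le (fun _ => by positivity) (fun n => ?_)
    (summable_prod_pi (fun i n => Real.exp (-(Real.pi * c / 2) * (n + ((a.1 i).val : ℝ) / 2) ^ 2
      + 2 * Real.pi * |(z i).im| * |(n : ℝ) + ((a.1 i).val : ℝ) / 2|))
      (fun _ _ => (Real.exp_pos _).le) (fun i => summable_exp_quadratic (by positivity) _ _))
  rw [norm_thetaTerm, ← Real.exp_add, ← Real.exp_sum]
  apply Real.exp_le_exp.mpr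
  have h1 := mul_le_mul_of_nonneg_left (hle (realShift n a.1)) hpi.le
  have h2 : -∑ i, realShift n a.1 i * (z i).im ≤ ∑ i, |(z i).im| * |realShift n a.1 i| := by
    rw [← Finset.sum_neg_distrib]
    refine Finset.sum_le_sum fun i _ => ?_
    rw [← abs_mul, mul_comm]
    exact neg_le_abs _
  have h3 : ∑ i, ‖shift n a.1 i‖ ^ 2 = ∑ i, realShift n a.1 i ^ 2 := by
    simp [norm_shift]
  have h4 : ∑ i, (-(Real.pi * c / 2) * ((n i : ℝ) + ((a.1 i).val : ℝ) / 2) ^ 2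
      + 2 * Real.pi * |(z i).im| * |(n i : ℝ) + ((a.1 i).val : ℝ) / 2|) =
      -(Real.pi * c / 2) * ∑ i, realShift n a.1 i ^ 2
        + 2 * Real.pi * ∑ i, |(z i).im| * |realShift n a.1 i| := by
    rw [Finset.sum_add_distrib, Finset.mul_sum, Finset.mul_sum]
    simp only [realShift, mul_assoc]
  rw [h3, h4]
  nlinarith [mul_le_mul_of_nonneg_left h2 hpi.le]

lemma summable_thetaTerm {g : ℕ} {τ : Matrix (Fin g) (Fin g) ℂ} (hτ : τ ∈ halfSpace g)
    (a : Characteristic g) (z : Fin g → ℂ) : Summable (thetaTerm a z τ) := by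
  obtain ⟨ε, hε, h⟩ := exists_summable_norm_thetaTerm_mul_exp hτ
  refine Summable.of_norm_bounded (h a z) fun n => ?_
  refine le_mul_of_one_le_right (norm_nonneg _) (Real.one_le_exp (by positivity))

/-! ### Derivatives as moments -/

/-- Termwise differentiation of a series of exponentials along a line. It covers both the
`z`-derivatives and the `τ`-derivatives of theta series. -/
lemma hasDerivAt_tsum_exp {ι : Type*} (A c : ι → ℂ) {ρ : ℝ} (hρ : 0 < ρ)
    (h : Summable fun n => ‖Complex.exp (A n)‖ * Real.exp (ρ * ‖c n‖)) :
    HasDerivAt (fun t : ℂ => ∑' n, Complex.exp (A n + t * c n))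
      (∑' n, Complex.exp (A n) * c n) 0 := by
  have key := hasDerivAt_tsum_of_isPreconnected (𝕜 := ℂ)
    (g := fun n t => Complex.exp (A n + t * c n))
    (g' := fun n t => Complex.exp (A n + t * c n) * c n)
    (t := Metric.ball (0 : ℂ) (ρ / 2)) (y₀ := 0) (y := 0)
    (h.mul_left (2 / ρ)) Metric.isOpen_ball
    (convex_ball _ _).isPreconnected ?_ ?_ (by simpa using hρ) ?_ (by simpa using hρ)
  · simpa using key
  · intro n t _
    simpa using (((hasDerivAt_id t).mul_const (c n)).const_add (A n)).cexp
  · intro n t ht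
    have ht' : ‖t‖ ≤ ρ / 2 := by simpa using (Metric.mem_ball.mp ht).le
    have h1 : ‖Complex.exp (t * c n)‖ ≤ Real.exp (ρ / 2 * ‖c n‖) := by
      rw [Complex.norm_exp]
      apply Real.exp_le_exp.mpr
      calc (t * c n).re ≤ ‖t * c n‖ := Complex.re_le_norm _
        _ = ‖t‖ * ‖c n‖ := norm_mul _ _
        _ ≤ _ := by gcongr
    have h2 : ‖c n‖ ≤ 2 / ρ * Real.exp (ρ / 2 * ‖c n‖) := by
      have := Real.add_one_le_exp (ρ / 2 * ‖c n‖)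
      calc ‖c n‖ = 2 / ρ * (ρ / 2 * ‖c n‖) := by field_simp
        _ ≤ _ := by gcongr; linarith
    calc ‖Complex.exp (A n + t * c n) * c n‖
        = ‖Complex.exp (A n)‖ * ‖Complex.exp (t * c n)‖ * ‖c n‖ := by
          rw [Complex.exp_add, norm_mul, norm_mul]
      _ ≤ ‖Complex.exp (A n)‖ * Real.exp (ρ / 2 * ‖c n‖) *
          (2 / ρ * Real.exp (ρ / 2 * ‖c n‖)) := by gcongr
      _ = 2 / ρ * (‖Complex.exp (A n)‖ * Real.exp (ρ * ‖c n‖)) := by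
          rw [show ρ * ‖c n‖ = ρ / 2 * ‖c n‖ + ρ / 2 * ‖c n‖ by ring, Real.exp_add]
          ring
  · refine Summable.of_norm_bounded h fun n => ?_
    simpa using le_mul_of_one_le_right (norm_nonneg (Complex.exp (A n)))
      (Real.one_le_exp (by positivity : 0 ≤ ρ * ‖c n‖))

/-- The `k`-th moment of the theta series at `z = 0` in the direction `j`, that is
`((1 / 2πi) ∂/∂z_j)^k ϑ_a` at `z = 0`, as a series. -/
noncomputable def moment {g : ℕ} (a : Characteristic g) (j : Fin g)
    (τ : Matrix (Fin g) (Fin g) ℂ) (k : ℕ) : ℂ :=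
  ∑' n : Fin g → ℤ, shift n a.1 j ^ k * thetaTerm a 0 τ n

lemma moment_zero {g : ℕ} (a : Characteristic g) (j : Fin g) (τ : Matrix (Fin g) (Fin g) ℂ) :
    moment a j τ 0 = thetanull a τ := by
  simp [moment, thetanull, theta]

lemma norm_shift_sq_le {g : ℕ} (n : Fin g → ℤ) (u : Fin g → ZMod 2) (j : Fin g) :
    ‖shift n u j‖ ^ 2 ≤ ∑ i, ‖shift n u i‖ ^ 2 :=
  Finset.single_le_sum (f := fun i => ‖shift n u i‖ ^ 2) (fun _ _ => by positivity)
    (Finset.mem_univ j)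

lemma summable_norm_moment {g : ℕ} {τ : Matrix (Fin g) (Fin g) ℂ} (hτ : τ ∈ halfSpace g)
    (a : Characteristic g) (j : Fin g) (k : ℕ) :
    Summable fun n => ‖shift n a.1 j ^ k * thetaTerm a 0 τ n‖ := by
  obtain ⟨ε, hε, h⟩ := exists_summable_norm_thetaTerm_mul_exp hτ
  refine Summable.of_nonneg_of_le (fun _ => norm_nonneg _) (fun n => ?_)
    ((h a 0).mul_left (1 + k.factorial / ε ^ k))
  set x := ‖shift n a.1 j‖ with hx
  have hx0 : 0 ≤ x := norm_nonneg _
  -- `x ^ k ≤ 1 + x ^ (2 * k)`, and `(ε x²) ^ k / k!` is a term of the series of `exp (ε x²)`.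
  have h1 : x ^ k ≤ 1 + (x ^ 2) ^ k := by
    rw [← pow_mul, mul_comm, pow_mul]
    nlinarith [sq_nonneg (x ^ k - 1), pow_nonneg hx0 k]
  have h2 : (x ^ 2) ^ k ≤ k.factorial / ε ^ k * Real.exp (ε * x ^ 2) := by
    have := Real.pow_div_factorial_le_exp (ε * x ^ 2) (by positivity) k
    rw [div_le_iff₀ (by positivity), mul_pow] at this
    rw [div_mul_eq_mul_div, le_div_iff₀ (by positivity)]
    linarith
  have h3 : 1 ≤ Real.exp (ε * x ^ 2) := Real.one_le_exp (by positivity)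
  have h4 : Real.exp (ε * x ^ 2) ≤ Real.exp (ε * ∑ i, ‖shift n a.1 i‖ ^ 2) :=
    Real.exp_le_exp.mpr (by gcongr; exact norm_shift_sq_le n a.1 j)
  have h5 : x ^ k ≤ (1 + k.factorial / ε ^ k) * Real.exp (ε * ∑ i, ‖shift n a.1 i‖ ^ 2) :=
    calc x ^ k ≤ (1 + k.factorial / ε ^ k) * Real.exp (ε * x ^ 2) := by linarith
      _ ≤ _ := by gcongr
  rw [norm_mul, norm_pow, ← hx]
  calc x ^ k * ‖thetaTerm a 0 τ n‖ ≤ _ := mul_le_mul_of_nonneg_right h5 (norm_nonneg _)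
    _ = _ := by ring

lemma hasLineDerivAt_theta {g : ℕ} {τ : Matrix (Fin g) (Fin g) ℂ} (hτ : τ ∈ halfSpace g)
    (a : Characteristic g) (j : Fin g) :
    HasLineDerivAt ℂ (fun z : Fin g → ℂ => theta a z τ)
      (2 * Real.pi * Complex.I * moment a j τ 1) 0 (Pi.single j 1) := by
  obtain ⟨ε, hε, h⟩ := exists_summable_norm_thetaTerm_mul_exp hτ
  have hsum : Summable fun n => ‖thetaTerm a 0 τ n‖ *
      Real.exp (1 * ‖2 * Real.pi * Complex.I * shift n a.1 j‖) := by
    refine Summable.of_nonneg_of_le (fun _ => by positivity) (fun n => ?_)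
      ((h a 0).mul_left (Real.exp (Real.pi ^ 2 / ε)))
    have h1 : 1 * ‖2 * Real.pi * Complex.I * shift n a.1 j‖ ≤
        Real.pi ^ 2 / ε + ε * ∑ i, ‖shift n a.1 i‖ ^ 2 := by
      have h2 := mul_le_mul_of_nonneg_left (norm_shift_sq_le n a.1 j) hε.le
      have h3 : 2 * Real.pi * ‖shift n a.1 j‖ - ε * ‖shift n a.1 j‖ ^ 2 ≤ Real.pi ^ 2 / ε := by
        rw [le_div_iff₀ hε]
        nlinarith [sq_nonneg (ε * ‖shift n a.1 j‖ - Real.pi)]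
      have h4 : ‖2 * Real.pi * Complex.I * shift n a.1 j‖ = 2 * Real.pi * ‖shift n a.1 j‖ := by
        simp [abs_of_pos Real.pi_pos]
      rw [h4]
      linarith
    calc _ ≤ ‖thetaTerm a 0 τ n‖ *
          Real.exp (Real.pi ^ 2 / ε + ε * ∑ i, ‖shift n a.1 i‖ ^ 2) := by gcongr
      _ = _ := by rw [Real.exp_add]; ring
  have key := hasDerivAt_tsum_exp _ _ one_pos hsum
  refine (key.congr_deriv ?_).congr_of_eventuallyEq
    (.of_forall fun t => tsum_congr fun n => ?_)
  · rw [moment, ← tsum_mul_left]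
    refine tsum_congr fun n => ?_
    rw [thetaTerm]
    ring
  · rw [thetaTerm]
    congr 1
    simp only [dotProduct_add, dotProduct_smul, dotProduct_single, zero_add, smul_eq_mul]
    ring

lemma hasLineDerivAt_thetanull {g : ℕ} {τ : Matrix (Fin g) (Fin g) ℂ} (hτ : τ ∈ halfSpace g)
    (a : Characteristic g) (j : Fin g) :
    HasLineDerivAt ℂ (thetanull a) (Real.pi * Complex.I * moment a j τ 2) τ (coordDir j j) := by
  obtain ⟨ε, hε, h⟩ := exists_summable_norm_thetaTerm_mul_exp hτ
  have hsum : Summable fun n => ‖thetaTerm a 0 τ n‖ *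
      Real.exp (ε / Real.pi * ‖Real.pi * Complex.I * shift n a.1 j ^ 2‖) := by
    refine Summable.of_nonneg_of_le (fun _ => by positivity) (fun n => ?_) (h a 0)
    have h4 : ε / Real.pi * ‖Real.pi * Complex.I * shift n a.1 j ^ 2‖ =
        ε * ‖shift n a.1 j‖ ^ 2 := by
      have := Real.pi_ne_zero
      simp only [norm_mul, Complex.norm_real, Real.norm_eq_abs, abs_of_pos Real.pi_pos,
        Complex.norm_I, norm_pow, mul_one]
      field_simp
    rw [h4]
    gcongr
    exact norm_shift_sq_le n a.1 j
  have key := hasDerivAt_tsum_exp _ _ (by have := Real.pi_pos; positivity) hsum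
  refine (key.congr_deriv ?_).congr_of_eventuallyEq
    (.of_forall fun t => tsum_congr fun n => ?_)
  · rw [moment, ← tsum_mul_left]
    refine tsum_congr fun n => ?_
    rw [thetaTerm]
    ring
  · rw [thetaTerm]
    congr 1
    have h5 : shift n a.1 ⬝ᵥ (Matrix.single j j (1 : ℂ)).mulVec (shift n a.1) =
        shift n a.1 j ^ 2 := by
      simp [Matrix.single_mulVec, sq, Function.update_apply, dotProduct]
    rw [coordDir, if_pos rfl, Matrix.add_mulVec, Matrix.smul_mulVec, dotProduct_add,
      dotProduct_smul, h5, smul_eq_mul]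
    ring

lemma thetaDeriv_eq_moment {g : ℕ} {τ : Matrix (Fin g) (Fin g) ℂ} (hτ : τ ∈ halfSpace g)
    (a : Characteristic g) (j : Fin g) :
    thetaDeriv a j τ = 2 * Real.pi * Complex.I * moment a j τ 1 :=
  (hasLineDerivAt_theta hτ a j).lineDeriv

/-- The heat equation `(1/πi) ∂/∂τ_jj = ((1/2πi) ∂/∂z_j)²` for theta functions, at `z = 0`. -/
lemma delta_thetanull_eq_moment {g : ℕ} {τ : Matrix (Fin g) (Fin g) ℂ} (hτ : τ ∈ halfSpace g)
    (a : Characteristic g) (j : Fin g) :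
    delta j j (thetanull a) τ = moment a j τ 2 := by
  have := Complex.ofReal_ne_zero.mpr Real.pi_ne_zero
  have := Complex.I_ne_zero
  rw [delta, if_pos rfl, (hasLineDerivAt_thetanull hτ a j).lineDeriv]
  field_simp

/-! ### Characters of one coordinate -/

/-- The sign `(-1)^x` of an element `x` of `ℤ/2ℤ`. -/
def sign2 (x : ZMod 2) : ℤ := (-1) ^ x.val

lemma sign2_add (x y : ZMod 2) : sign2 (x + y) = sign2 x * sign2 y := by
  revert x y; decide

lemma sign2_mul (x y : ZMod 2) : sign2 (x * y) = (-1) ^ (x.val * y.val) := by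
  revert x y; decide

lemma prod_sign2_mul {g : ℕ} (u v : Fin g → ZMod 2) :
    ∏ i, sign2 (u i * v i) = (-1) ^ pairing u v := by
  simp only [sign2_mul, pairing, Finset.prod_pow_eq_pow_sum]

/-- In one coordinate, the indicator function of the condition `k ≡ u mod 2` times the phase
`exp (2πi · (k/2) · (v/2))`, written as a power of `i`. -/
noncomputable def charWeight (u v : ZMod 2) (k : ℤ) : ℂ :=
  if (k : ZMod 2) = u then Complex.I ^ (k * v.val) else 0

lemma I_zpow_two_mul (m : ℤ) : Complex.I ^ (2 * m) = (-1 : ℂ) ^ m := by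
  rw [zpow_mul]
  norm_num [zpow_ofNat]

lemma neg_one_zpow_eq_sign2 (m : ℤ) : (-1 : ℂ) ^ m = (sign2 (m : ZMod 2) : ℂ) := by
  rcases Int.even_or_odd m with h | h
  · rw [h.neg_one_zpow, (ZMod.intCast_eq_zero_iff_even).mpr h]
    simp [sign2]
  · rw [h.neg_one_zpow, (ZMod.intCast_eq_one_iff_odd).mpr h]
    simp [sign2, ZMod.val_one]

lemma charWeight_neg (u v : ZMod 2) (k : ℤ) :
    charWeight u v (-k) = (sign2 (u * v) : ℂ) * charWeight u v k := by
  have h2 : ((-k : ℤ) : ZMod 2) = (k : ZMod 2) := by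
    rw [Int.cast_neg, ZMod.neg_eq_self_mod_two]
  unfold charWeight
  rw [h2]
  split_ifs with h
  · have h3 : (sign2 (u * v) : ℂ) = Complex.I ^ (2 * (-k * v.val)) := by
      rw [I_zpow_two_mul, neg_one_zpow_eq_sign2, Int.cast_mul, h2, h]
      simp
    rw [h3, ← zpow_add₀ Complex.I_ne_zero]
    congr 1
    ring
  · simp

/-- A product of two weights with even sum `2s` of the arguments is `0` or `±1`, and depends only
on parities. -/
lemma charWeight_mul_charWeight (u v : ZMod 2) {k l s : ℤ} (h : k + l = 2 * s) :
    charWeight u v k * charWeight u v l =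
      ((if (k : ZMod 2) = u then sign2 (v * s) else 0 : ℤ) : ℂ) := by
  have hl : (l : ZMod 2) = k := by
    have : ((k + l : ℤ) : ZMod 2) = ((2 * s : ℤ) : ZMod 2) := by rw [h]
    push_cast at this
    rw [show (2 : ZMod 2) = 0 from rfl, zero_mul] at this
    rw [eq_neg_of_add_eq_zero_right this, ZMod.neg_eq_self_mod_two]
  unfold charWeight
  rw [hl]
  split_ifs with hk
  · rw [← zpow_add₀ Complex.I_ne_zero, ← add_mul, h, mul_assoc, I_zpow_two_mul,
      neg_one_zpow_eq_sign2]
    simp [mul_comm]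
  · simp

lemma charWeight_mul_charWeight_of_odd (u v : ZMod 2) {k l : ℤ} (h : Odd (k + l)) :
    charWeight u v k * charWeight u v l = 0 := by
  have hl : (l : ZMod 2) ≠ k := by
    intro hl
    have := (ZMod.intCast_eq_one_iff_odd).mpr h
    rw [Int.cast_add, hl, CharTwo.add_self_eq_zero] at this
    exact zero_ne_one this
  unfold charWeight
  split_ifs with h1 h2 <;> simp
  exact absurd (h2.trans h1.symm) hl

/-- The sign, in one coordinate, with which the characteristic `b` occurs in Riemann's theta
formula for the characteristics `a` and `c`. -/
def localSign (a c b : ZMod 2 × ZMod 2) : ℤ :=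
  sign2 ((a.2 + c.2) * a.1 + c.2 * b.1 + a.1 * b.2)

/-- The identity of signs behind Riemann's theta formula, in one coordinate. Here `k`, `l` stand for
the first and third entries of a quadruple, `s`, `t` for the half sums of its first and of its last
two entries, all modulo `2`. -/
lemma sum_localSign_mul : ∀ (a c : ZMod 2 × ZMod 2) (s t k l : ZMod 2),
    2 * ((if s + t = a.1 then sign2 (a.2 * s) else 0) *
        (if (k + s) + (l + t) = c.1 then sign2 (c.2 * (k + s)) else 0)) =
      ∑ b : ZMod 2 × ZMod 2, localSign a c b *
        ((if k = b.1 then sign2 (b.2 * s) else 0) *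
          (if l = (a + b + c).1 then sign2 ((a + b + c).2 * t) else 0)) := by
  decide

/-- Riemann's theta formula for the weights, in one coordinate: orthogonality of characters
detects the image of a coset of `ℤ⁴` under one half of the Hadamard matrix. -/
lemma charWeight_hadamard (a c : ZMod 2 × ZMod 2) {k₁ k₂ k₃ k₄ l₁ l₂ l₃ l₄ : ℤ}
    (h₁ : 2 * l₁ = k₁ + k₂ + k₃ + k₄) (h₂ : 2 * l₂ = k₁ + k₂ - k₃ - k₄)
    (h₃ : 2 * l₃ = k₁ - k₂ + k₃ - k₄) (h₄ : 2 * l₄ = k₁ - k₂ - k₃ + k₄) :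
    charWeight a.1 a.2 l₁ * charWeight a.1 a.2 l₂ *
        (charWeight c.1 c.2 l₃ * charWeight c.1 c.2 l₄) =
      1 / 2 * ∑ b : ZMod 2 × ZMod 2, (localSign a c b : ℂ) *
        (charWeight b.1 b.2 k₁ * charWeight b.1 b.2 k₂ *
          (charWeight (a + b + c).1 (a + b + c).2 k₃ *
            charWeight (a + b + c).1 (a + b + c).2 k₄)) := by
  rcases Int.even_or_odd' (k₁ + k₂) with ⟨s, hs | hs⟩
  · obtain ⟨t, ht⟩ : ∃ t, k₃ + k₄ = 2 * t := ⟨l₁ - s, by omega⟩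
    have hl₁ : ((l₁ : ℤ) : ZMod 2) = s + t := by
      rw [show l₁ = s + t by omega, Int.cast_add]
    have hl₃ : ((l₃ : ℤ) : ZMod 2) = (k₁ + s) + (k₃ + t) := by
      rw [show l₃ = (k₁ - s) + (k₃ - t) by omega]
      push_cast
      rw [CharTwo.sub_eq_add, CharTwo.sub_eq_add]
    have hks : ((k₁ - s : ℤ) : ZMod 2) = k₁ + s := by
      push_cast
      rw [CharTwo.sub_eq_add]
    rw [charWeight_mul_charWeight a.1 a.2 (show l₁ + l₂ = 2 * s by omega),
      charWeight_mul_charWeight c.1 c.2 (show l₃ + l₄ = 2 * (k₁ - s) by omega)]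
    simp only [charWeight_mul_charWeight _ _ hs, charWeight_mul_charWeight _ _ ht]
    rw [hl₁, hl₃, hks]
    have := congrArg (fun x : ℤ => (x : ℂ)) (sum_localSign_mul a c s t k₁ k₃)
    simp only [Int.cast_mul, Int.cast_sum, Int.cast_ofNat] at this
    rw [← this]
    ring
  · have hodd : Odd (k₁ + k₂) := ⟨s, hs⟩
    rw [charWeight_mul_charWeight_of_odd a.1 a.2 (show Odd (l₁ + l₂) from ⟨s, by omega⟩)]
    simp only [charWeight_mul_charWeight_of_odd _ _ hodd, zero_mul, mul_zero,
      Finset.sum_const_zero]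

/-- If the sum of the four entries is odd, no characteristic contributes. -/
lemma charWeight_mul_eq_zero_of_odd_sum (a c : ZMod 2 × ZMod 2) {k₁ k₂ k₃ k₄ : ℤ}
    (h : ¬ Even (k₁ + k₂ + k₃ + k₄)) :
    charWeight a.1 a.2 k₁ * charWeight a.1 a.2 k₂ *
      (charWeight c.1 c.2 k₃ * charWeight c.1 c.2 k₄) = 0 := by
  rw [Int.not_even_iff_odd] at h
  rcases Int.even_or_odd (k₁ + k₂) with h1 | h1
  · rw [charWeight_mul_charWeight_of_odd c.1 c.2 (k := k₃), mul_zero]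
    rw [show k₃ + k₄ = (k₁ + k₂ + k₃ + k₄) - (k₁ + k₂) by ring]
    exact h.sub_even h1
  · rw [charWeight_mul_charWeight_of_odd a.1 a.2 h1, zero_mul]

/-! ### Theta series over the doubled lattice -/

/-- The Gaussian `exp (πi ᵗ(k/2) τ (k/2))`. -/
noncomputable def gaussian {g : ℕ} (τ : Matrix (Fin g) (Fin g) ℂ) (k : Fin g → ℤ) : ℂ :=
  Complex.exp (Real.pi * Complex.I / 4 * ∑ i, ∑ l, τ i l * ((k i : ℂ) * (k l : ℂ)))

/-- The theta series at `z = 0` as a series over all `k ∈ ℤ^g`, where `k = 2n + a'`; the terms with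
`k ≢ a'` modulo `2` vanish. -/
noncomputable def latticeTerm {g : ℕ} (a : Characteristic g) (τ : Matrix (Fin g) (Fin g) ℂ)
    (k : Fin g → ℤ) : ℂ :=
  (∏ i, charWeight (a.1 i) (a.2 i) (k i)) * gaussian τ k

lemma latticeTerm_neg {g : ℕ} (a : Characteristic g) (τ : Matrix (Fin g) (Fin g) ℂ)
    (k : Fin g → ℤ) : latticeTerm a τ (-k) = (-1) ^ a.abs * latticeTerm a τ k := by
  have h : ((-1 : ℂ)) ^ a.abs = ∏ i, (sign2 (a.1 i * a.2 i) : ℂ) := by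
    rw [← Int.cast_prod, prod_sign2_mul]
    simp [Characteristic.abs]
  simp [latticeTerm, gaussian, charWeight_neg, h, Finset.prod_mul_distrib, mul_assoc]

lemma latticeTerm_double {g : ℕ} (a : Characteristic g) (τ : Matrix (Fin g) (Fin g) ℂ)
    (n : Fin g → ℤ) :
    latticeTerm a τ (fun i => 2 * n i + (a.1 i).val) = thetaTerm a 0 τ n := by
  have hI (m : ℤ) : Complex.I ^ m = Complex.exp (m * (Real.pi / 2 * Complex.I)) := by
    rw [Complex.exp_int_mul, Complex.exp_pi_div_two_mul_I]
  have hc (i : Fin g) : charWeight (a.1 i) (a.2 i) (2 * n i + (a.1 i).val) =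
      Complex.exp (2 * Real.pi * Complex.I * (shift n a.1 i * (((a.2 i).val : ℂ) / 2))) := by
    have h2 : (2 : ZMod 2) = 0 := rfl
    have hcast : ((2 * n i + ((a.1 i).val : ℤ) : ℤ) : ZMod 2) = a.1 i := by
      simp [h2]
    rw [charWeight, if_pos hcast, hI]
    congr 1
    simp only [shift]
    push_cast
    ring
  rw [latticeTerm, gaussian, thetaTerm]
  simp only [hc]
  rw [← Complex.exp_sum, ← Complex.exp_add, add_comm]
  congr 1
  simp only [dotProduct, Matrix.mulVec, Finset.mul_sum, zero_add]
  congr 1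
  refine Finset.sum_congr rfl fun i _ => Finset.sum_congr rfl fun l _ => ?_
  simp only [shift]
  push_cast
  ring

lemma latticeTerm_eq_zero {g : ℕ} (a : Characteristic g) (τ : Matrix (Fin g) (Fin g) ℂ)
    {k : Fin g → ℤ} (hk : k ∉ Set.range fun (n : Fin g → ℤ) i => 2 * n i + ((a.1 i).val : ℤ)) :
    latticeTerm a τ k = 0 := by
  by_contra h
  apply hk
  have hcong (i : Fin g) : (k i : ZMod 2) = a.1 i := by
    by_contra hi
    exact h (mul_eq_zero_of_left (Finset.prod_eq_zero (Finset.mem_univ i) (if_neg hi)) _)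
  have hdvd (i : Fin g) : (2 : ℤ) ∣ k i - (a.1 i).val := by
    exact_mod_cast (ZMod.intCast_zmod_eq_zero_iff_dvd (k i - (a.1 i).val) 2).mp (by simp [hcong i])
  choose n hn using hdvd
  exact ⟨n, funext fun i => by have := hn i; simp only; omega⟩

lemma double_injective {g : ℕ} (u : Fin g → ZMod 2) :
    Function.Injective fun (n : Fin g → ℤ) i => 2 * n i + ((u i).val : ℤ) := by
  intro n m h
  funext i
  have := congrFun h i
  simp only at this
  omega

lemma summable_norm_latticeTerm {g : ℕ} {τ : Matrix (Fin g) (Fin g) ℂ} (hτ : τ ∈ halfSpace g)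
    (a : Characteristic g) (j : Fin g) (e : ℕ) :
    Summable fun k : Fin g → ℤ => ‖((k j : ℂ) / 2) ^ e * latticeTerm a τ k‖ := by
  rw [← (double_injective a.1).summable_iff fun k hk => by rw [latticeTerm_eq_zero a τ hk]; simp]
  refine (summable_norm_moment hτ a j e).congr fun n => ?_
  simp only [Function.comp, latticeTerm_double, shift]
  congr 3
  push_cast
  ring

lemma hasSum_latticeTerm {g : ℕ} {τ : Matrix (Fin g) (Fin g) ℂ} (hτ : τ ∈ halfSpace g)
    (a : Characteristic g) (j : Fin g) (e : ℕ) :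
    HasSum (fun k : Fin g → ℤ => ((k j : ℂ) / 2) ^ e * latticeTerm a τ k) (moment a j τ e) := by
  rw [← (double_injective a.1).hasSum_iff fun k hk => by rw [latticeTerm_eq_zero a τ hk]; simp]
  refine (summable_norm_moment hτ a j e).of_norm.hasSum.congr_fun fun n => ?_
  simp only [Function.comp, latticeTerm_double, shift]
  congr 2
  push_cast
  ring

/-- A theta function has the parity of its characteristic, by the substitution `k ↦ -k`. -/
lemma moment_eq_zero {g : ℕ} {τ : Matrix (Fin g) (Fin g) ℂ} (hτ : τ ∈ halfSpace g)
    (a : Characteristic g) (j : Fin g) {e : ℕ} (h : Odd (e + a.abs)) : moment a j τ e = 0 := by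
  have h1 := hasSum_latticeTerm hτ a j e
  have h2 := (Equiv.neg (Fin g → ℤ)).hasSum_iff.mpr h1
  have h3 : HasSum (fun k : Fin g → ℤ => ((k j : ℂ) / 2) ^ e * latticeTerm a τ k)
      (-moment a j τ e) := by
    refine h2.neg.congr_fun ?_
    intro k
    have : (-1 : ℂ) ^ e * (-1) ^ a.abs = -1 := by rw [← pow_add, h.neg_one_pow]
    simp only [Function.comp, Equiv.neg_apply, latticeTerm_neg, Pi.neg_apply, Int.cast_neg]
    rw [neg_div, neg_pow]
    linear_combination (((k j : ℂ) / 2) ^ e * latticeTerm a τ k) * this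
  exact self_eq_neg.mp (h1.unique h3)

/-! ### Riemann's theta formula -/

/-- Quadruples of lattice points. -/
abbrev Quad (g : ℕ) : Type :=
  ((Fin g → ℤ) × (Fin g → ℤ)) × ((Fin g → ℤ) × (Fin g → ℤ))

/-- The product of the terms of four theta series, two of characteristic `a` and two of
characteristic `c`. -/
noncomputable def quadTerm {g : ℕ} (a c : Characteristic g) (τ : Matrix (Fin g) (Fin g) ℂ)
    (K : Quad g) : ℂ :=
  latticeTerm a τ K.1.1 * latticeTerm a τ K.1.2 * (latticeTerm c τ K.2.1 * latticeTerm c τ K.2.2)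

/-- One half of the Hadamard matrix of order four, on quadruples of lattice points. The halves are
rounded, so this is meaningful only on quadruples whose sum is even. -/
def hadamard {g : ℕ} (K : Quad g) : Quad g :=
  ((fun i => (K.1.1 i + K.1.2 i + K.2.1 i + K.2.2 i) / 2,
    fun i => (K.1.1 i + K.1.2 i - K.2.1 i - K.2.2 i) / 2),
   (fun i => (K.1.1 i - K.1.2 i + K.2.1 i - K.2.2 i) / 2,
    fun i => (K.1.1 i - K.1.2 i - K.2.1 i + K.2.2 i) / 2))

/-- The quadruples of lattice points with even sum. -/
def EvenSum {g : ℕ} (K : Quad g) : Prop :=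
  ∀ i, Even (K.1.1 i + K.1.2 i + K.2.1 i + K.2.2 i)

lemma EvenSum.two_mul_hadamard {g : ℕ} {K : Quad g} (hK : EvenSum K) (i : Fin g) :
    2 * (hadamard K).1.1 i = K.1.1 i + K.1.2 i + K.2.1 i + K.2.2 i ∧
    2 * (hadamard K).1.2 i = K.1.1 i + K.1.2 i - K.2.1 i - K.2.2 i ∧
    2 * (hadamard K).2.1 i = K.1.1 i - K.1.2 i + K.2.1 i - K.2.2 i ∧
    2 * (hadamard K).2.2 i = K.1.1 i - K.1.2 i - K.2.1 i + K.2.2 i := by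
  obtain ⟨s, hs⟩ := hK i
  simp only [hadamard]
  omega

lemma EvenSum.hadamard {g : ℕ} {K : Quad g} (hK : EvenSum K) : EvenSum (hadamard K) := by
  intro i
  obtain ⟨h1, h2, h3, h4⟩ := hK.two_mul_hadamard i
  exact ⟨K.1.1 i, by omega⟩

lemma EvenSum.hadamard_hadamard {g : ℕ} {K : Quad g} (hK : EvenSum K) :
    SiegelTheta.hadamard (SiegelTheta.hadamard K) = K := by
  have h (i : Fin g) := hK.two_mul_hadamard i
  have h' (i : Fin g) := hK.hadamard.two_mul_hadamard i
  refine Prod.ext (Prod.ext ?_ ?_) (Prod.ext ?_ ?_) <;> funext i <;>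
    have h1 := h i <;> have h2 := h' i <;> omega

open Classical in
/-- The involution of the set of quadruples that is `hadamard` where the sum is even and
the identity elsewhere. -/
noncomputable def hadamardPerm (g : ℕ) : Equiv.Perm (Quad g) :=
  Function.Involutive.toPerm (fun K => if EvenSum K then hadamard K else K) fun K => by
    by_cases hK : EvenSum K
    · simp [hK, hK.hadamard, hK.hadamard_hadamard]
    · simp [hK]

lemma hadamardPerm_of_evenSum {g : ℕ} {K : Quad g} (hK : EvenSum K) :
    hadamardPerm g K = hadamard K := if_pos hK

lemma hadamardPerm_of_not_evenSum {g : ℕ} {K : Quad g} (hK : ¬ EvenSum K) :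
    hadamardPerm g K = K := if_neg hK

/-- The sign with which the characteristic `b` occurs in Riemann's theta formula for the
characteristics `a` and `c`. -/
def riemannSign {g : ℕ} (a c b : Characteristic g) : ℤ :=
  ∏ i, localSign (a.1 i, a.2 i) (c.1 i, c.2 i) (b.1 i, b.2 i)

lemma prod_sum_eq_sum_characteristic {g : ℕ} (h : Fin g → ZMod 2 × ZMod 2 → ℂ) :
    ∏ i, ∑ β, h i β = ∑ b : Characteristic g, ∏ i, h i (b.1 i, b.2 i) := by
  rw [Finset.prod_univ_sum, Fintype.piFinset_univ]
  exact Fintype.sum_equiv (Equiv.arrowProdEquivProdArrow _ _ _) _ _ fun b => rfl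

/-- One half of the Hadamard matrix is orthogonal, so it preserves sums of quadratic forms. -/
lemma gaussian_hadamard {g : ℕ} (τ : Matrix (Fin g) (Fin g) ℂ) {K : Quad g} (hK : EvenSum K) :
    gaussian τ (hadamard K).1.1 * gaussian τ (hadamard K).1.2 *
        (gaussian τ (hadamard K).2.1 * gaussian τ (hadamard K).2.2) =
      gaussian τ K.1.1 * gaussian τ K.1.2 * (gaussian τ K.2.1 * gaussian τ K.2.2) := by
  simp only [gaussian, ← Complex.exp_add, ← mul_add, ← Finset.sum_add_distrib]
  congr 2
  refine Finset.sum_congr rfl fun i _ => Finset.sum_congr rfl fun l _ => ?_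
  congr 1
  have h (i : Fin g) :
      ((hadamard K).1.1 i : ℂ) = (K.1.1 i + K.1.2 i + K.2.1 i + K.2.2 i) / 2 ∧
      ((hadamard K).1.2 i : ℂ) = (K.1.1 i + K.1.2 i - K.2.1 i - K.2.2 i) / 2 ∧
      ((hadamard K).2.1 i : ℂ) = (K.1.1 i - K.1.2 i + K.2.1 i - K.2.2 i) / 2 ∧
      ((hadamard K).2.2 i : ℂ) = (K.1.1 i - K.1.2 i - K.2.1 i + K.2.2 i) / 2 := by
    obtain ⟨h1, h2, h3, h4⟩ := hK.two_mul_hadamard i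
    refine ⟨?_, ?_, ?_, ?_⟩ <;> rw [eq_div_iff two_ne_zero, mul_comm]
    · exact_mod_cast h1
    · exact_mod_cast h2
    · exact_mod_cast h3
    · exact_mod_cast h4
  obtain ⟨h1, h2, h3, h4⟩ := h i
  obtain ⟨h1', h2', h3', h4'⟩ := h l
  rw [h1, h2, h3, h4, h1', h2', h3', h4']
  ring

lemma quadTerm_eq {g : ℕ} (a c : Characteristic g) (τ : Matrix (Fin g) (Fin g) ℂ) (K : Quad g) :
    quadTerm a c τ K =
      (∏ i, (charWeight (a.1 i) (a.2 i) (K.1.1 i) * charWeight (a.1 i) (a.2 i) (K.1.2 i) *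
        (charWeight (c.1 i) (c.2 i) (K.2.1 i) * charWeight (c.1 i) (c.2 i) (K.2.2 i)))) *
      (gaussian τ K.1.1 * gaussian τ K.1.2 * (gaussian τ K.2.1 * gaussian τ K.2.2)) := by
  simp only [quadTerm, latticeTerm, Finset.prod_mul_distrib]
  ring

/-- Riemann's theta formula, term by term. -/
lemma quadTerm_hadamard {g : ℕ} (a c : Characteristic g) (τ : Matrix (Fin g) (Fin g) ℂ)
    {K : Quad g} (hK : EvenSum K) :
    quadTerm a c τ (hadamard K) =
      (1 / 2) ^ g * ∑ b, (riemannSign a c b : ℂ) * quadTerm b (a + b + c) τ K := by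
  have hprod := fun i : Fin g => charWeight_hadamard (a.1 i, a.2 i) (c.1 i, c.2 i)
    (hK.two_mul_hadamard i).1 (hK.two_mul_hadamard i).2.1 (hK.two_mul_hadamard i).2.2.1
    (hK.two_mul_hadamard i).2.2.2
  simp only [quadTerm_eq, gaussian_hadamard τ hK, hprod, Finset.prod_mul_distrib,
    Finset.prod_const, Finset.card_univ, Fintype.card_fin, prod_sum_eq_sum_characteristic]
  rw [mul_assoc, Finset.sum_mul]
  congr 1
  refine Finset.sum_congr rfl fun b _ => ?_
  simp only [riemannSign, Int.cast_prod, Prod.fst_add, Prod.snd_add,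
    Pi.add_apply]
  ring

lemma quadTerm_eq_zero {g : ℕ} (a c : Characteristic g) (τ : Matrix (Fin g) (Fin g) ℂ)
    {K : Quad g} (hK : ¬ EvenSum K) : quadTerm a c τ K = 0 := by
  obtain ⟨i, hi⟩ := not_forall.mp hK
  rw [quadTerm_eq, Finset.prod_eq_zero (Finset.mem_univ i), zero_mul]
  exact charWeight_mul_eq_zero_of_odd_sum (a.1 i, a.2 i) (c.1 i, c.2 i) hi

/-- Riemann's theta formula with weights: if the weights `W` and `W'` correspond to each
other under one half of the Hadamard matrix, the series weighted by `W` for the characteristics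
`a, a, c, c` is a signed sum of the series weighted by `W'` for `b, b, a + b + c, a + b + c`. -/
theorem hasSum_riemann {g : ℕ} {τ : Matrix (Fin g) (Fin g) ℂ} (a c : Characteristic g) (j : Fin g)
    {W W' : ℂ → ℂ → ℂ → ℂ → ℂ}
    (hW : ∀ p q r s, W ((p + q + r + s) / 2) ((p + q - r - s) / 2) ((p - q + r - s) / 2)
      ((p - q - r + s) / 2) = W' p q r s)
    {R : Characteristic g → ℂ}
    (hR : ∀ b, HasSum (fun K : Quad g => W' (K.1.1 j / 2) (K.1.2 j / 2) (K.2.1 j / 2)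
      (K.2.2 j / 2) * quadTerm b (a + b + c) τ K) (R b)) :
    HasSum (fun K : Quad g => W (K.1.1 j / 2) (K.1.2 j / 2) (K.2.1 j / 2) (K.2.2 j / 2) *
      quadTerm a c τ K) ((1 / 2) ^ g * ∑ b, (riemannSign a c b : ℂ) * R b) := by
  rw [← (hadamardPerm g).hasSum_iff]
  refine ((hasSum_sum fun b _ => (hR b).mul_left (riemannSign a c b : ℂ)).mul_left
    ((1 / 2) ^ g)).congr_fun fun K => ?_
  by_cases hK : EvenSum K
  · have hw : W ((hadamard K).1.1 j / 2) ((hadamard K).1.2 j / 2) ((hadamard K).2.1 j / 2)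
        ((hadamard K).2.2 j / 2) =
        W' (K.1.1 j / 2) (K.1.2 j / 2) (K.2.1 j / 2) (K.2.2 j / 2) := by
      rw [← hW]
      obtain ⟨h1, h2, h3, h4⟩ := hK.two_mul_hadamard j
      have h1' := congrArg (fun x : ℤ => (x : ℂ)) h1
      have h2' := congrArg (fun x : ℤ => (x : ℂ)) h2
      have h3' := congrArg (fun x : ℤ => (x : ℂ)) h3
      have h4' := congrArg (fun x : ℤ => (x : ℂ)) h4
      push_cast at h1' h2' h3' h4'
      congr 1
      · linear_combination h1' / 4
      · linear_combination h2' / 4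
      · linear_combination h3' / 4
      · linear_combination h4' / 4
    simp only [Function.comp, hadamardPerm_of_evenSum hK, quadTerm_hadamard a c τ hK, hw,
      Finset.mul_sum]
    refine Finset.sum_congr rfl fun b _ => ?_
    ring
  · simp only [Function.comp, hadamardPerm_of_not_evenSum hK, quadTerm_eq_zero _ _ τ hK, mul_zero,
      Finset.sum_const_zero]

lemma hasSum_quadTerm {g : ℕ} {τ : Matrix (Fin g) (Fin g) ℂ} (hτ : τ ∈ halfSpace g)
    (a c : Characteristic g) (j : Fin g) (e₁ e₂ e₃ e₄ : ℕ) :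
    HasSum (fun K : Quad g => ((K.1.1 j : ℂ) / 2) ^ e₁ * ((K.1.2 j : ℂ) / 2) ^ e₂ *
        ((K.2.1 j : ℂ) / 2) ^ e₃ * ((K.2.2 j : ℂ) / 2) ^ e₄ * quadTerm a c τ K)
      (moment a j τ e₁ * moment a j τ e₂ * (moment c j τ e₃ * moment c j τ e₄)) := by
  have hs := summable_norm_latticeTerm hτ
  have hm := hasSum_latticeTerm hτ
  have n1 := (hs a j e₁).mul_norm (hs a j e₂)
  have n2 := (hs c j e₃).mul_norm (hs c j e₄)
  have h1 := (hm a j e₁).mul (hm a j e₂) n1.of_norm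
  have h2 := (hm c j e₃).mul (hm c j e₄) n2.of_norm
  have h3 := h1.mul h2 (n1.mul_norm n2).of_norm
  refine h3.congr_fun fun K => ?_
  rw [quadTerm]
  ring

/-! ### Signs for odd characteristics -/

lemma char_add_add_self {g : ℕ} (a b : Characteristic g) : a + b + a = b := by
  have h : ∀ x y : ZMod 2, x + y + x = y := by decide
  exact Prod.ext (funext fun i => h _ _) (funext fun i => h _ _)

lemma char_add_add_cancel {g : ℕ} (a b : Characteristic g) : a + (a + b) = b := by
  rw [add_comm a b, ← add_assoc, char_add_add_self]

lemma riemannSign_zero {g : ℕ} {a : Characteristic g} (ha : Odd a.abs) (b : Characteristic g) :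
    riemannSign a 0 b = -(-1) ^ pairing a.1 b.2 := by
  have h : riemannSign a 0 b = ∏ i, sign2 (a.1 i * a.2 i) * sign2 (a.1 i * b.2 i) := by
    refine Finset.prod_congr rfl fun i _ => ?_
    rw [← sign2_add, localSign]
    congr 1
    simp
    ring
  rw [h, Finset.prod_mul_distrib, prod_sign2_mul, prod_sign2_mul]
  change (-1) ^ a.abs * _ = _
  rw [ha.neg_one_pow, neg_one_mul]

lemma riemannSign_zero_add {g : ℕ} {a : Characteristic g} (ha : Odd a.abs)
    (b : Characteristic g) : riemannSign a 0 (a + b) = -riemannSign a 0 b := by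
  rw [riemannSign_zero ha, riemannSign_zero ha, ← prod_sign2_mul, ← prod_sign2_mul]
  simp only [Prod.snd_add, Pi.add_apply, mul_add, sign2_add, Finset.prod_mul_distrib,
    prod_sign2_mul]
  change -((-1) ^ a.abs * _) = _
  rw [ha.neg_one_pow]
  ring

lemma riemannSign_self {g : ℕ} {a b : Characteristic g} (ha : Odd a.abs) (hb : Even b.abs) :
    riemannSign a a b = -(-1) ^ (a + b).abs := by
  have h : ∏ i, sign2 ((a + b).1 i * (a + b).2 i) =
      (∏ i, sign2 (a.1 i * a.2 i)) * (∏ i, sign2 (b.1 i * b.2 i)) * riemannSign a a b := by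
    rw [riemannSign, ← Finset.prod_mul_distrib, ← Finset.prod_mul_distrib]
    refine Finset.prod_congr rfl fun i _ => ?_
    rw [localSign, ← sign2_add, ← sign2_add, CharTwo.add_self_eq_zero]
    congr 1
    simp only [Prod.fst_add, Prod.snd_add, Pi.add_apply]
    ring
  rw [prod_sign2_mul, prod_sign2_mul, prod_sign2_mul] at h
  change (-1) ^ (a + b).abs = (-1) ^ a.abs * (-1) ^ b.abs * _ at h
  rw [h, ha.neg_one_pow, hb.neg_one_pow]
  ring

/-- The translation `b ↦ a + b` by an odd characteristic changes the sign `riemannSign a 0 b`. -/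
lemma sum_riemannSign_zero_add {g : ℕ} {a : Characteristic g} (ha : Odd a.abs)
    (F : Characteristic g → ℂ) :
    ∑ b, (riemannSign a 0 b : ℂ) * F (a + b) = -∑ b, (riemannSign a 0 b : ℂ) * F b := by
  rw [← Equiv.sum_comp (Equiv.addLeft a) fun b => (riemannSign a 0 b : ℂ) * F b,
    ← Finset.sum_neg_distrib]
  refine Finset.sum_congr rfl fun b _ => ?_
  rw [Equiv.coe_addLeft, riemannSign_zero_add ha]
  push_cast
  ring

lemma sum_evenChars {g : ℕ} {F : Characteristic g → ℂ} (hF : ∀ b, Odd b.abs → F b = 0) :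
    ∑ b ∈ evenChars g, F b = ∑ b, F b := by
  refine Finset.sum_subset (Finset.subset_univ _) fun b _ hb => hF b ?_
  simpa [evenChars] using hb

/-! ### The two relations between moments -/

/-! The next two lemmas are `HasSum.mul_left` and `HasSum.add` with the standard instances of `ℂ` in
their statements. With the general lemmas the instances of the resulting `HasSum` are syntactically
different, and comparing two long linear combinations becomes expensive. -/

lemma hasSum_const_mul {ι : Type*} {f : ι → ℂ} {A : ℂ} (c : ℂ) (h : HasSum f A) :
    HasSum (fun i => c * f i) (c * A) := h.mul_left c

lemma hasSum_add {ι : Type*} {f f' : ι → ℂ} {A A' : ℂ} (h : HasSum f A) (h' : HasSum f' A') :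
    HasSum (fun i => f i + f' i) (A + A') := h.add h'

lemma hasSum_of_eq {ι : Type*} {f f' : ι → ℂ} {A A' : ℂ} (h : HasSum f A)
    (hf : ∀ i, f' i = f i) (hA : A' = A) : HasSum f' A' := by
  rw [hA]
  exact h.congr_fun hf

/-- Riemann's formula for the characteristics `a, a, 0, 0` and the weight
`xy + uv = (p² + q² - r² - s²) / 2`. The product `uv` contributes nothing, since `ϑ_a` vanishes
at `z = 0`; it is there to make the transform free of mixed terms, hence of first moments. -/
lemma moment_one_sq_mul_thetanull_sq {g : ℕ} {τ : Matrix (Fin g) (Fin g) ℂ}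
    (hτ : τ ∈ halfSpace g) {a : Characteristic g} (ha : Odd a.abs) (j : Fin g) :
    moment a j τ 1 ^ 2 * thetanull 0 τ ^ 2 = 2 * (1 / 2) ^ g *
      ∑ b ∈ evenChars g, (-1) ^ pairing a.1 b.2 *
        (thetanull b τ ^ 2 * (thetanull (a + b) τ * moment (a + b) j τ 2)) := by
  have H := hasSum_quadTerm hτ
  have hL : HasSum (fun K : Quad g => ((K.1.1 j : ℂ) / 2 * ((K.1.2 j : ℂ) / 2) +
      (K.2.1 j : ℂ) / 2 * ((K.2.2 j : ℂ) / 2)) * quadTerm a 0 τ K)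
      (moment a j τ 1 ^ 2 * thetanull 0 τ ^ 2 + thetanull a τ ^ 2 * moment 0 j τ 1 ^ 2) := by
    refine hasSum_of_eq ((H a 0 j 1 1 0 0).add (H a 0 j 0 0 1 1)) (fun K => ?_) ?_
    · ring
    · simp only [moment_zero]
      ring
  have hR (b : Characteristic g) : HasSum (fun K : Quad g => 1 / 2 * (((K.1.1 j : ℂ) / 2) ^ 2 +
      ((K.1.2 j : ℂ) / 2) ^ 2 - ((K.2.1 j : ℂ) / 2) ^ 2 - ((K.2.2 j : ℂ) / 2) ^ 2) *
        quadTerm b (a + b + 0) τ K)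
      (thetanull (a + b) τ ^ 2 * (thetanull b τ * moment b j τ 2) -
        thetanull b τ ^ 2 * (thetanull (a + b) τ * moment (a + b) j τ 2)) := by
    rw [add_zero]
    refine hasSum_of_eq (hasSum_const_mul (1 / 2)
      (((H b (a + b) j 2 0 0 0).add (H b (a + b) j 0 2 0 0)).add
        (hasSum_const_mul (-1) ((H b (a + b) j 0 0 2 0).add (H b (a + b) j 0 0 0 2)))))
      (fun K => ?_) ?_
    · ring
    · simp only [moment_zero]
      ring
  have key := hL.unique (hasSum_riemann a 0 j (W := fun x y u v => x * y + u * v)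
    (W' := fun p q r s => 1 / 2 * (p ^ 2 + q ^ 2 - r ^ 2 - s ^ 2))
    (fun p q r s => by ring) hR)
  have ha0 : thetanull a τ = 0 := by
    rw [← moment_zero a j]
    exact moment_eq_zero hτ a j (by simpa using ha)
  -- The translation `b ↦ a + b` identifies the two halves of the sum.
  have hsplit := sum_riemannSign_zero_add ha fun b =>
    thetanull b τ ^ 2 * (thetanull (a + b) τ * moment (a + b) j τ 2)
  simp only [char_add_add_cancel] at hsplit
  simp only [mul_sub, Finset.sum_sub_distrib, hsplit, ha0] at key
  rw [sum_evenChars]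
  · have hneg : ∑ b, (riemannSign a 0 b : ℂ) *
        (thetanull b τ ^ 2 * (thetanull (a + b) τ * moment (a + b) j τ 2)) =
        -∑ b, (-1) ^ pairing a.1 b.2 *
          (thetanull b τ ^ 2 * (thetanull (a + b) τ * moment (a + b) j τ 2)) := by
      rw [← Finset.sum_neg_distrib]
      refine Finset.sum_congr rfl fun b _ => ?_
      rw [riemannSign_zero ha]
      push_cast
      ring
    rw [hneg] at key
    linear_combination key
  · intro b hb
    rw [← moment_zero b j, moment_eq_zero hτ b j (by simpa using hb)]
    simp

/-- The terms for `b` and `a + b` cancel, because the sign changes under this translation. -/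
lemma sum_thetanull_sq_mul_thetanull_sq {g : ℕ} {τ : Matrix (Fin g) (Fin g) ℂ}
    (hτ : τ ∈ halfSpace g) {a : Characteristic g} (ha : Odd a.abs) (j : Fin g) :
    ∑ b ∈ evenChars g, (-1 : ℂ) ^ pairing a.1 b.2 *
      (thetanull b τ ^ 2 * thetanull (a + b) τ ^ 2) = 0 := by
  rw [sum_evenChars]
  · have h := sum_riemannSign_zero_add ha fun b => thetanull b τ ^ 2 * thetanull (a + b) τ ^ 2
    simp only [char_add_add_cancel, riemannSign_zero ha] at h
    push_cast at h
    simp only [neg_mul, Finset.sum_neg_distrib, neg_neg, mul_comm (thetanull (a + _) τ ^ 2)] at h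
    exact neg_eq_self.mp h
  · intro b hb
    rw [← moment_zero b j, moment_eq_zero hτ b j (by simpa using hb)]
    simp

/-- A quartic form in which `xyuv` is the only monomial that involves all variables. -/
def quarticWeight (x y u v : ℂ) : ℂ :=
  48 * (x * y * u * v) - 6 * (x ^ 4 + y ^ 4 + u ^ 4 + v ^ 4) -
    4 * (x ^ 2 * y ^ 2 + x ^ 2 * u ^ 2 + x ^ 2 * v ^ 2 + y ^ 2 * u ^ 2 + y ^ 2 * v ^ 2 +
      u ^ 2 * v ^ 2)

/-- The transform of `quarticWeight`: a multiple of the second elementary symmetric function of the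
squares. -/
def quarticWeightDual (p q r s : ℂ) : ℂ :=
  -16 * (p ^ 2 * q ^ 2 + p ^ 2 * r ^ 2 + p ^ 2 * s ^ 2 + q ^ 2 * r ^ 2 + q ^ 2 * s ^ 2 +
    r ^ 2 * s ^ 2)

lemma quarticWeight_hadamard (p q r s : ℂ) :
    quarticWeight ((p + q + r + s) / 2) ((p + q - r - s) / 2) ((p - q + r - s) / 2)
      ((p - q - r + s) / 2) = quarticWeightDual p q r s := by
  simp only [quarticWeight, quarticWeightDual]
  ring

/-- Riemann's formula for the characteristics `a, a, a, a` and the weight `quarticWeight`. Only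
the monomial `xyuv` contributes for `a`, since `ϑ_a` vanishes at `z = 0`, and only even `b`
contribute on the other side. -/
lemma moment_one_pow_four {g : ℕ} {τ : Matrix (Fin g) (Fin g) ℂ}
    (hτ : τ ∈ halfSpace g) {a : Characteristic g} (ha : Odd a.abs) (j : Fin g) :
    moment a j τ 1 ^ 4 = 2 * (1 / 2) ^ g *
      ∑ b ∈ evenChars g, (-1) ^ (a + b).abs * (thetanull b τ ^ 2 * moment b j τ 2 ^ 2) := by
  have H := hasSum_quadTerm hτ
  have hL : HasSum (fun K : Quad g => quarticWeight (K.1.1 j / 2) (K.1.2 j / 2)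
      (K.2.1 j / 2) (K.2.2 j / 2) *
      quadTerm a a τ K) (48 * moment a j τ 1 ^ 4 - 24 * (moment a j τ 4 * thetanull a τ ^ 3) -
        24 * (moment a j τ 2 ^ 2 * thetanull a τ ^ 2)) := by
    have h₄ := hasSum_add (hasSum_add (hasSum_add (H a a j 4 0 0 0) (H a a j 0 4 0 0))
      (H a a j 0 0 4 0)) (H a a j 0 0 0 4)
    have h₂ := hasSum_add (hasSum_add (hasSum_add (hasSum_add (hasSum_add (H a a j 2 2 0 0)
      (H a a j 2 0 2 0)) (H a a j 2 0 0 2)) (H a a j 0 2 2 0)) (H a a j 0 2 0 2))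
      (H a a j 0 0 2 2)
    have h := hasSum_add (hasSum_add (hasSum_const_mul 48 (H a a j 1 1 1 1))
      (hasSum_const_mul (-6) h₄)) (hasSum_const_mul (-4) h₂)
    refine hasSum_of_eq h (fun K => ?_) ?_
    · rw [quarticWeight]
      ring
    · simp only [moment_zero]
      ring
  have hR (b : Characteristic g) : HasSum (fun K : Quad g => quarticWeightDual (K.1.1 j / 2)
      (K.1.2 j / 2) (K.2.1 j / 2) (K.2.2 j / 2) *
      quadTerm b (a + b + a) τ K) (-96 * (thetanull b τ ^ 2 * moment b j τ 2 ^ 2)) := by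
    rw [char_add_add_self]
    have h₂ := hasSum_add (hasSum_add (hasSum_add (hasSum_add (hasSum_add (H b b j 2 2 0 0)
      (H b b j 2 0 2 0)) (H b b j 2 0 0 2)) (H b b j 0 2 2 0)) (H b b j 0 2 0 2))
      (H b b j 0 0 2 2)
    refine hasSum_of_eq (hasSum_const_mul (-16) h₂) (fun K => ?_) ?_
    · rw [quarticWeightDual]
      ring
    · simp only [moment_zero]
      ring
  have key := hL.unique (hasSum_riemann a a j quarticWeight_hadamard hR)
  have ha0 : thetanull a τ = 0 := by
    rw [← moment_zero a j]
    exact moment_eq_zero hτ a j (by simpa using ha)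
  rw [ha0] at key
  have hodd (b : Characteristic g) (hb : Odd b.abs) : thetanull b τ = 0 := by
    rw [← moment_zero b j]
    exact moment_eq_zero hτ b j (by simpa using hb)
  rw [← sum_evenChars fun b hb => by simp [hodd b hb]] at key
  have hsum : ∑ b ∈ evenChars g, (riemannSign a a b : ℂ) *
        (-96 * (thetanull b τ ^ 2 * moment b j τ 2 ^ 2)) =
      96 * ∑ b ∈ evenChars g,
        (-1) ^ (a + b).abs * (thetanull b τ ^ 2 * moment b j τ 2 ^ 2) := by
    rw [Finset.mul_sum]
    refine Finset.sum_congr rfl fun b hb => ?_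
    rw [riemannSign_self ha (by simpa [evenChars] using hb)]
    push_cast
    ring
  rw [hsum] at key
  linear_combination key / 48

lemma one_div_two_zpow (g : ℕ) : 1 / (2 : ℂ) ^ ((g : ℤ) - 1) = 2 * (1 / 2) ^ g := by
  rw [zpow_sub₀ two_ne_zero, zpow_natCast, zpow_one, one_div_div, one_div_pow]
  ring

lemma thetanull_mul_psi {g : ℕ} {τ : Matrix (Fin g) (Fin g) ℂ} (hτ : τ ∈ halfSpace g)
    (c : Characteristic g) (j : Fin g) :
    thetanull c τ ^ 2 * psi c j j τ = thetanull c τ * moment c j τ 2 := by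
  rw [psi, delta_thetanull_eq_moment hτ]
  by_cases h : thetanull c τ = 0
  · simp [h]
  · field_simp

end SiegelTheta

open SiegelTheta in
theorem proposition4 (g : ℕ) (τ : Matrix (Fin g) (Fin g) ℂ)
    (hτ : τ ∈ SiegelTheta.halfSpace g) :
    -- the theta series converge absolutely, and the derivatives below exist
    ((∀ (b : SiegelTheta.Characteristic g) (z : Fin g → ℂ),
        Summable (SiegelTheta.thetaTerm b z τ)) ∧
      (∀ (b : SiegelTheta.Characteristic g) (j : Fin g),
        LineDifferentiableAt ℂ (fun z : Fin g → ℂ => SiegelTheta.theta b z τ) 0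
          (Pi.single j 1)) ∧
      (∀ (b : SiegelTheta.Characteristic g) (j : Fin g),
        LineDifferentiableAt ℂ (SiegelTheta.thetanull b) τ (SiegelTheta.coordDir j j))) ∧
    ∀ a ∈ SiegelTheta.oddChars g, ∀ j : Fin g,
      -- (i)
      (SiegelTheta.thetanull 0 τ ≠ 0 →
        (1 / (2 * Real.pi * Complex.I * SiegelTheta.thetanull 0 τ)
            * SiegelTheta.thetaDeriv a j τ) ^ 2
          = 1 / (2 : ℂ) ^ ((g : ℤ) - 1) * ∑ b ∈ SiegelTheta.evenChars g,
              (-1 : ℂ) ^ SiegelTheta.pairing a.1 b.2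
                * (SiegelTheta.thetanull (a + b) τ / SiegelTheta.thetanull 0 τ) ^ 2
                * (SiegelTheta.thetanull b τ / SiegelTheta.thetanull 0 τ) ^ 2
                * (SiegelTheta.psi (a + b) j j τ - SiegelTheta.psi 0 j j τ)) ∧
      -- (ii)
      (1 / (2 * Real.pi * Complex.I) * SiegelTheta.thetaDeriv a j τ) ^ 4
        = 1 / (2 : ℂ) ^ ((g : ℤ) - 1) * ∑ b ∈ SiegelTheta.evenChars g,
            (-1 : ℂ) ^ SiegelTheta.Characteristic.abs (a + b)
              * SiegelTheta.thetanull b τ ^ 4 * SiegelTheta.psi b j j τ ^ 2 := by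
  have hpi : (2 * Real.pi * Complex.I : ℂ) ≠ 0 := Complex.two_pi_I_ne_zero
  refine ⟨⟨fun b z => summable_thetaTerm hτ b z,
    fun b j => (hasLineDerivAt_theta hτ b j).lineDifferentiableAt,
    fun b j => (hasLineDerivAt_thetanull hτ b j).lineDifferentiableAt⟩, fun a ha j => ?_⟩
  have ha' : Odd a.abs := by simpa [oddChars] using ha
  rw [one_div_two_zpow, thetaDeriv_eq_moment hτ]
  refine ⟨fun h0 => ?_, ?_⟩
  · have hmain := moment_one_sq_mul_thetanull_sq hτ ha' j
    have hzero := sum_thetanull_sq_mul_thetanull_sq hτ ha' j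
    have hsum : ∑ b ∈ evenChars g, (-1 : ℂ) ^ pairing a.1 b.2 *
          (thetanull (a + b) τ / thetanull 0 τ) ^ 2 * (thetanull b τ / thetanull 0 τ) ^ 2 *
          (psi (a + b) j j τ - psi 0 j j τ) =
        (∑ b ∈ evenChars g, (-1 : ℂ) ^ pairing a.1 b.2 *
          (thetanull b τ ^ 2 * (thetanull (a + b) τ * moment (a + b) j τ 2)) -
        psi 0 j j τ * ∑ b ∈ evenChars g, (-1 : ℂ) ^ pairing a.1 b.2 *
          (thetanull b τ ^ 2 * thetanull (a + b) τ ^ 2)) / thetanull 0 τ ^ 4 := by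
      rw [Finset.mul_sum, ← Finset.sum_sub_distrib, Finset.sum_div]
      refine Finset.sum_congr rfl fun b _ => ?_
      rw [← thetanull_mul_psi hτ (a + b) j]
      field_simp
    rw [hsum, hzero, mul_zero, sub_zero, mul_div_assoc', ← hmain]
    field_simp
  · rw [one_div, inv_mul_cancel_left₀ hpi, moment_one_pow_four hτ ha' j]
    congr 1
    refine Finset.sum_congr rfl fun b _ => ?_
    have h := thetanull_mul_psi hτ b j
    linear_combination (-(-1 : ℂ) ^ (a + b).abs *
      (thetanull b τ ^ 2 * psi b j j τ + thetanull b τ * moment b j τ 2)) * h
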